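/- Let $K$ be a field of characteristic zero, and let $\sigma_x,\sigma_y$ be the automorphisms of $K(x,y)$ over $K$ given by $\sigma_x(f(x,y))=f(x+1,y)$, $\sigma_y(f(x,y))=f(x,y+1)$. **Definitions.** - A rational function $f\in K(x,y)$ is *$\sigma_y$-summable* if $f=\sigma_y(g)-g$ for some $g\in K(x,y)$. A nonzero polynomial $f\in K[x,y]$ is *$\sigma_y$-free* if $\gcd(f,\sigma_y^\ell(f))\in K[x]$ for all nonzero integers $\ell$. A rational function $r$ is a *$\sigma_y$-remainder* (of $f$) if $f-r$ is $\sigma_y$-summable, the numerator of $r$ has smaller degree in $y$ than its denominator, and the denominator of $r$ is $\sigma_y$-free. - A *telescoper* for $f\in K(x,y)$ is a nonzero recurrence operator $L=\sum_{\ell}c_\ell S_x^\ell\in K[x][S_x]$ (with $S_xc=\sigma_x(c)S_x$) such that $L(f)=\sum_\ell c_\ell\,\sigma_x^\ell(f)$ is $\sigma_y$-summable. Its *order* is its degree in $S_x$, and its *degree* is the maximum of the degrees in $x$ of the $c_\ell$. - An irreducible polynomial in $K[x,y]$ is *integer-linear* if it has the form $p(\lambda x+\mu y)$ with $\lambda,\mu\in\mathbb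 Z$ and $p\in K[z]$; a polynomial is integer-linear if all its irreducible factors are. Polynomials $f,g\in K[x,y]$ are *$(\sigma_x,\sigma_y)$-equivalent* if $f=\sigma_x^k\sigma_y^l(g)$ for some $k,l\in\mathbb Z$. - A *refined integer-linear decomposition* of $b\in K[x,y]$ is a factorization $$b=p_0(x,y)\prod_{i=1}^m\prod_{j=1}^{n_i}p_i(\lambda_ix+\mu_iy+\nu_{ij})^{e_{ij}}$$ in which $p_0\in K[x,y]$ has no integer-linear irreducible factor of positive degree in $y$; $p_1,\dots,p_m\in K[z]$ are monic and irreducible; $\lambda_i,\mu_i\in\mathbb Z$ with $\gcd(\lambda_i,\mu_i)=1$ and $\mu_i>0$; the polynomials $p_i(\lambda_ix+\mu_iy)$, $1\le i\le m$, are pairwise not $(\sigma_x,\sigma_y)$-equivalent; and $m\ge 0$, $n_i\ge 1$, $\nu_{ij}$, $e_{ij}$ are nonnegative integers with $0=\nu_{i1}<\dots<\nu_{in_i}$ and $e_{ij}>0$. **Lemma.** Let $r=a/(ub)\in K(x,y)$ be a $\sigma_y$-remainder, where $0\ne u\in K[x]$ and $a,b\in K[x,y]$ with $\deg_y(a)<\deg_y(b)$,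 $\gcd(a,ub)=1$, and $b$ is primitive with respect to $y$, $\sigma_y$-free and integer-linear. Let $b$ have the refined integer-linear decomposition displayed above, and put $$\rho_0=\sum_{i=1}^m\mu_i\deg_z(p_i)\max\{e_{i1},\dots,e_{in_i}\}.$$ Then for all nonnegative integers $\rho,\tau$ with $\rho\ge\rho_0$ and $$\tau>\frac{\bigl((\rho+1)\deg_x(b)\deg_y(b)+\rho\deg_x(u)+\deg_x(a)+\rho_0\bigr)\rho_0-\tfrac12\rho_0(\rho_0-1)-(\rho+1)}{\rho+1-\rho_0},$$ there exists a telescoper for $r$ of order at most $\rho$ and degree at most $\tau$. (If $a=0$, which forces $\rho_0=0$, the term $\deg_x(a)$ is read as $0$.) -/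

import Mathlib

noncomputable section

namespace RationalCT

open Polynomial

/-- The polynomial ring `K[x,y]`, presented as `K[x][y]`: the inner variable is `x`, the outer
variable is `y`. Thus `C u` is the element `u` of `K[x]` seen in `K[x,y]`, `Polynomial.degree` is
the degree in `y` (with value `⊥` at `0`), and `Polynomial.IsPrimitive` is primitivity with
respect to `y`. -/
abbrev PolyXY (K : Type*) [Field K] : Type _ := Polynomial (Polynomial K)

/-- The field `K(x,y)`. -/
abbrev RatXY (K : Type*) [Field K] : Type _ := FractionRing (PolyXY K)

section

variable {K : Type*} [Field K]

/-- The variable `x` of `K[x,y]`. -/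
def varX : PolyXY K := C X

/-- The variable `y` of `K[x,y]`. -/
def varY : PolyXY K := X

/-- The degree in `x` of a polynomial in `K[x,y]`, as a natural number (`0` at the zero
polynomial). -/
def degX (f : PolyXY K) : ℕ := f.support.sup fun j => (f.coeff j).natDegree

/-- `σ_x` on `K[x,y]`: `f(x,y) ↦ f(x+1,y)`. -/
def sigmaX : PolyXY K ≃ₐ[K] PolyXY K := mapAlgEquiv (taylorEquiv (1 : K))

/-- `σ_y` on `K[x,y]`: `f(x,y) ↦ f(x,y+1)`. -/
def sigmaY : PolyXY K ≃ₐ[K] PolyXY K := (taylorEquiv (1 : K[X])).restrictScalars K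

/-- `σ_x` on `K(x,y)`. -/
def ratSigmaX : RatXY K ≃+* RatXY K :=
  IsFractionRing.ringEquivOfRingEquiv (sigmaX (K := K)).toRingEquiv

/-- `σ_y` on `K(x,y)`. -/
def ratSigmaY : RatXY K ≃+* RatXY K :=
  IsFractionRing.ringEquivOfRingEquiv (sigmaY (K := K)).toRingEquiv

lemma sigmaX_varX : sigmaX (varX : PolyXY K) = varX + 1 := by
  have h : taylorEquiv (1 : K) X = X + C 1 := taylor_X (1 : K)
  simp [sigmaX, varX, h]

lemma sigmaX_varY : sigmaX (varY : PolyXY K) = varY := by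
  simp [sigmaX, varY]

lemma sigmaY_varX : sigmaY (varX : PolyXY K) = varX := taylor_C (1 : K[X]) X

lemma sigmaY_varY : sigmaY (varY : PolyXY K) = varY + 1 := taylor_X (1 : K[X])

lemma ratSigmaX_algebraMap (f : PolyXY K) :
    ratSigmaX (algebraMap (PolyXY K) (RatXY K) f) = algebraMap (PolyXY K) (RatXY K) (sigmaX f) := by
  simp [ratSigmaX]

lemma ratSigmaY_algebraMap (f : PolyXY K) :
    ratSigmaY (algebraMap (PolyXY K) (RatXY K) f) = algebraMap (PolyXY K) (RatXY K) (sigmaY f) := by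
  simp [ratSigmaY]

/-- `f` is `σ_y`-summable: `f = σ_y(g) - g` for some rational function `g`. -/
def IsSummable (f : RatXY K) : Prop := ∃ g : RatXY K, f = ratSigmaY g - g

/-- A nonzero polynomial `f` is `σ_y`-free if `gcd(f, σ_y^ℓ(f))` lies in `K[x]` for every nonzero
integer `ℓ`, i.e. all common divisors of `f` and `σ_y^ℓ(f)` have degree `0` in `y`. -/
def IsShiftFree (f : PolyXY K) : Prop :=
  f ≠ 0 ∧ ∀ ℓ : ℤ, ℓ ≠ 0 → ∀ d : PolyXY K, d ∣ f → d ∣ (sigmaY ^ ℓ) f → d.natDegree = 0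

/-- `r` is a `σ_y`-remainder of `f`: `f - r` is `σ_y`-summable and, in lowest terms, `r = p / q`
with `deg_y p < deg_y q` and `q` `σ_y`-free. -/
def IsShiftRemainder (f r : RatXY K) : Prop :=
  IsSummable (f - r) ∧
    ∃ p q : PolyXY K, IsRelPrime p q ∧ p.degree < q.degree ∧ IsShiftFree q ∧
      r = algebraMap (PolyXY K) (RatXY K) p / algebraMap (PolyXY K) (RatXY K) q

/-! ### Telescopers -/

/-- `K[x]` with the action of `ℕ` by powers of the shift `c(x) ↦ c(x+1)`. -/
instance shiftAction : MulSemiringAction (Multiplicative ℕ) K[X] :=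
  MulSemiringAction.compHom K[X] (powersHom (K[X] ≃ₐ[K] K[X]) (taylorEquiv (1 : K)))

variable (K) in
/-- The ring `K[x][S_x]` of recurrence operators `∑ c_ℓ S_x^ℓ`. -/
abbrev RecOp : Type _ := SkewPolynomial K[X]

/-- The commutation rule `S_x c = σ_x(c) S_x`. -/
lemma recOp_commutation (c : K[X]) :
    (SkewPolynomial.X * SkewPolynomial.C c : RecOp K) =
      SkewPolynomial.C (c.comp (X + 1)) * SkewPolynomial.X := by
  have h : (Multiplicative.ofAdd 1 : Multiplicative ℕ) • c = c.comp (X + 1) := by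
    change (powersHom (K[X] ≃ₐ[K] K[X]) (taylorEquiv (1 : K))) (Multiplicative.ofAdd 1) c = _
    have h1 : taylorEquiv (1 : K) c = c.comp (X + C 1) := taylor_apply (1 : K) c
    simpa [powersHom_apply] using h1
  rw [← h, ← SkewPolynomial.monomial_zero_left, ← SkewPolynomial.monomial_zero_left,
    SkewPolynomial.X_mul_monomial, SkewPolynomial.monomial_mul_X]
  rfl

/-- The application `L(f) = ∑ c_ℓ σ_x^ℓ(f)` of `L = ∑ c_ℓ S_x^ℓ` to a rational function `f`. -/
def RecOp.app (L : RecOp K) (f : RatXY K) : RatXY K :=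
  ∑ ℓ ∈ SkewPolynomial.support L,
    algebraMap (PolyXY K) (RatXY K) (C (SkewPolynomial.coeff L ℓ)) * (ratSigmaX ^ ℓ) f

/-- The order of `L`: its degree in `S_x` (`0` for the zero operator). -/
def RecOp.order (L : RecOp K) : ℕ := (SkewPolynomial.support L).sup id

/-- The degree of `L`: the maximal degree in `x` of its coefficients (`0` for the zero
operator). -/
def RecOp.deg (L : RecOp K) : ℕ :=
  (SkewPolynomial.support L).sup fun ℓ => (SkewPolynomial.coeff L ℓ).natDegree

/-- `L` is a telescoper for `f`. -/
def IsTelescoper (L : RecOp K) (f : RatXY K) : Prop := L ≠ 0 ∧ IsSummable (L.app f)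

/-! ### Integer-linear polynomials -/

/-- The polynomial `p(l x + m y + s)` in `K[x,y]`, for a univariate polynomial `p`. -/
def substLin (p : K[X]) (l m s : ℤ) : PolyXY K :=
  aeval ((l : PolyXY K) * varX + (m : PolyXY K) * varY + (s : PolyXY K)) p

/-- `q = p(l x + m y)` for some integers `l, m` and some univariate `p`; for irreducible `q` this
is the notion of an integer-linear irreducible polynomial. -/
def IsIntegerLinearIrred (q : PolyXY K) : Prop :=
  ∃ (l m : ℤ) (p : K[X]), q = substLin p l m 0

/-- A polynomial is integer-linear if all its irreducible factors are. -/
def IsIntegerLinear (g : PolyXY K) : Prop :=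
  ∀ q : PolyXY K, Irreducible q → q ∣ g → IsIntegerLinearIrred q

/-- `(σ_x, σ_y)`-equivalence of polynomials. -/
def ShiftEquivXY (f g : PolyXY K) : Prop :=
  ∃ k l : ℤ, f = (sigmaX ^ k) ((sigmaY ^ l) g)

/-- A refined integer-linear decomposition
`g = p₀(x,y) ∏_i ∏_j p_i(λ_i x + μ_i y + ν_ij)^(e_ij)`. -/
structure RefinedILD (g : PolyXY K) where
  p₀ : PolyXY K
  m : ℕ
  n : Fin m → ℕ
  p : Fin m → K[X]
  lam : Fin m → ℤ
  mu : Fin m → ℤ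
  nu : (i : Fin m) → Fin (n i) → ℕ
  e : (i : Fin m) → Fin (n i) → ℕ
  eq_prod : g = p₀ * ∏ i, ∏ j, substLin (p i) (lam i) (mu i) (nu i j) ^ e i j
  /-- No irreducible factor of `p₀` of positive degree in `y` is integer-linear. -/
  not_integerLinear : ∀ q : PolyXY K, Irreducible q → q ∣ p₀ → 0 < q.natDegree →
    ¬ IsIntegerLinearIrred q
  p_monic : ∀ i, (p i).Monic
  p_irreducible : ∀ i, Irreducible (p i)
  coprime : ∀ i, Int.gcd (lam i) (mu i) = 1
  mu_pos : ∀ i, 0 < mu i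
  not_shiftEquiv : ∀ i j, i < j →
    ¬ ShiftEquivXY (substLin (p i) (lam i) (mu i) 0) (substLin (p j) (lam j) (mu j) 0)
  n_pos : ∀ i, 0 < n i
  nu_zero : ∀ i, nu i ⟨0, n_pos i⟩ = 0
  nu_strictMono : ∀ i, StrictMono (nu i)
  e_pos : ∀ i j, 0 < e i j

/-- `ρ₀ = ∑_i μ_i deg_z(p_i) max_j e_ij`. -/
def RefinedILD.rho₀ {g : PolyXY K} (D : RefinedILD g) : ℤ :=
  ∑ i, D.mu i * ((D.p i).natDegree : ℤ) * ((Finset.univ.sup (D.e i) : ℕ) : ℤ)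

end

end RationalCT

end

namespace RationalCT

open Polynomial

variable {K : Type*} [Field K]

/-! ### Bounds for the total degree -/

/-! Applying `σ_y` to a term does not change it modulo summable functions, and `σ_y` fixes `K[x]`.
In `L(r) = ∑ c_ℓ σ_x^ℓ(r)` one may therefore decompose `r` into partial fractions in `y` and move
each summand of each `σ_x^ℓ(r)` by its own power of `σ_y`.

Integer-linearity makes this effective. Both shifts send `p(λx + μy + s)` to a polynomial of the
same form with another integer `s`, and `σ_y` changes `s` by `μ`, so every denominator can be
brought to `0 ≤ s < μ`. All denominators then divide one fixed polynomial of total degree at most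
`ρ₀`, up to factors in `K[x]` (`RefinedILD.exists_cofactor`). A telescoper results as soon as the
numerators over this common denominator satisfy a nontrivial linear relation over `K[x]`
(`exists_telescoper_of_relation`).

Such a relation exists by counting unknowns and equations over `K` (`exists_relation`). The
numerators have degree below `ρ₀` in `y`, and their total degree is bounded, so the coefficient of
`y^j` loses `j` from its degree bound in `x`; summed over `j < ρ₀`, this gives the term
`-ρ₀(ρ₀-1)/2`. The degrees in `x` of the partial fractions come from `exists_partialFractions`,
itself a dimension count, and the final inequality is `sum_range_lt_of_lt_div`. -/

variable (K) in
/-- The polynomials in `K[x,y]` of total degree at most `T`. -/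
def totalDegLE (T : ℕ) : Submodule K (PolyXY K) where
  carrier := {f | ∀ i j, T < i + j → (f.coeff j).coeff i = 0}
  zero_mem' := by simp
  add_mem' := by
    intro f g hf hg i j h
    simp [hf i j h, hg i j h]
  smul_mem' := by
    intro c f hf i j h
    simp [hf i j h]

lemma mem_totalDegLE {T : ℕ} {f : PolyXY K} :
    f ∈ totalDegLE K T ↔ ∀ i j, T < i + j → (f.coeff j).coeff i = 0 := Iff.rfl

lemma totalDegLE_mono {S T : ℕ} (h : S ≤ T) : totalDegLE K S ≤ totalDegLE K T :=
  fun _ hf i j hij => hf i j (h.trans_lt hij)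

lemma mul_mem_totalDegLE {S T : ℕ} {f g : PolyXY K} (hf : f ∈ totalDegLE K S)
    (hg : g ∈ totalDegLE K T) : f * g ∈ totalDegLE K (S + T) := by
  intro i j hij
  rw [coeff_mul, finsetSum_coeff]
  refine Finset.sum_eq_zero fun p hp => ?_
  rw [coeff_mul]
  refine Finset.sum_eq_zero fun q hq => ?_
  rw [Finset.HasAntidiagonal.mem_antidiagonal] at hp hq
  by_cases h : S < q.1 + p.1
  · rw [hf _ _ h, zero_mul]
  · rw [hg q.2 p.2 (by omega), mul_zero]

lemma C_mem_totalDegLE {T : ℕ} {c : K[X]} (h : c.natDegree ≤ T) :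
    (C c : PolyXY K) ∈ totalDegLE K T := by
  intro i j hij
  rw [coeff_C]
  split_ifs with hj
  · exact coeff_eq_zero_of_natDegree_lt (by omega)
  · simp

lemma one_mem_totalDegLE (T : ℕ) : (1 : PolyXY K) ∈ totalDegLE K T := by
  simpa using C_mem_totalDegLE (K := K) (T := T) (c := 1) (by simp)

lemma intCast_mem_totalDegLE (n : ℤ) (T : ℕ) : (n : PolyXY K) ∈ totalDegLE K T := by
  simpa using C_mem_totalDegLE (K := K) (T := T) (c := (n : K[X])) (by simp)

lemma varX_mem_totalDegLE : (varX : PolyXY K) ∈ totalDegLE K 1 :=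
  C_mem_totalDegLE (by simp)

lemma varY_mem_totalDegLE : (varY : PolyXY K) ∈ totalDegLE K 1 := by
  intro i j hij
  rw [varY, coeff_X]
  split_ifs with hj
  · rw [coeff_one, if_neg (by omega)]
  · simp

lemma pow_mem_totalDegLE {T : ℕ} {f : PolyXY K} (hf : f ∈ totalDegLE K T) (n : ℕ) :
    f ^ n ∈ totalDegLE K (n * T) := by
  induction n with
  | zero => simpa using one_mem_totalDegLE 0
  | succ n ih =>
    rw [pow_succ, Nat.succ_mul]
    exact mul_mem_totalDegLE ih hf

lemma prod_mem_totalDegLE {ι : Type*} (s : Finset ι) {f : ι → PolyXY K} {T : ι → ℕ}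
    (h : ∀ i ∈ s, f i ∈ totalDegLE K (T i)) : ∏ i ∈ s, f i ∈ totalDegLE K (∑ i ∈ s, T i) := by
  classical
  induction s using Finset.induction_on with
  | empty => simpa using one_mem_totalDegLE 0
  | insert a s ha ih =>
    rw [Finset.prod_insert ha, Finset.sum_insert ha]
    exact mul_mem_totalDegLE (h a (by simp)) (ih fun i hi => h i (by simp [hi]))

lemma aeval_mem_totalDegLE {w : PolyXY K} (hw : w ∈ totalDegLE K 1) (p : K[X]) :
    aeval w p ∈ totalDegLE K p.natDegree := by
  rw [aeval_eq_sum_range]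
  refine Submodule.sum_mem _ fun i hi => Submodule.smul_mem _ _ ?_
  refine totalDegLE_mono ?_ (pow_mem_totalDegLE hw i)
  have := Finset.mem_range.1 hi
  omega

lemma natDegree_le_of_mem_totalDegLE {T : ℕ} {f : PolyXY K} (hf : f ∈ totalDegLE K T) :
    f.natDegree ≤ T := by
  refine natDegree_le_iff_coeff_eq_zero.2 fun j hj => ?_
  ext i
  simpa using hf i j (by omega)

/-- The trade-off between the powers of `x` and `y` that makes the set of possible coefficients a
trapezoid instead of a rectangle in the final count. -/
lemma natDegree_coeff_add_le {T : ℕ} {f : PolyXY K} (hf : f ∈ totalDegLE K T) {j : ℕ}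
    (hj : f.coeff j ≠ 0) : (f.coeff j).natDegree + j ≤ T := by
  by_contra! h
  exact leadingCoeff_ne_zero.2 hj (hf _ j h)

lemma natDegree_coeff_le_degX (f : PolyXY K) (j : ℕ) : (f.coeff j).natDegree ≤ degX f := by
  by_cases hj : f.coeff j = 0
  · simp [hj]
  · exact Finset.le_sup (f := fun j => (f.coeff j).natDegree) (mem_support_iff.2 hj)

lemma degX_le_iff {f : PolyXY K} {n : ℕ} : degX f ≤ n ↔ ∀ j, (f.coeff j).natDegree ≤ n :=
  ⟨fun h j => (natDegree_coeff_le_degX f j).trans h, fun h => Finset.sup_le fun j _ => h j⟩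

lemma mem_totalDegLE_of_degX_natDegree {f : PolyXY K} {S T : ℕ} (hS : degX f ≤ S)
    (hT : f.natDegree ≤ T) : f ∈ totalDegLE K (S + T) := by
  intro i j hij
  by_cases hj : f.natDegree < j
  · simp [coeff_eq_zero_of_natDegree_lt hj]
  · exact coeff_eq_zero_of_natDegree_lt (by have := natDegree_coeff_le_degX f j; omega)

lemma coeff_coeff_swap (f : PolyXY K) (i j : ℕ) :
    ((Bivariate.swap f).coeff i).coeff j = (f.coeff j).coeff i := by
  induction f using Polynomial.induction_on' with
  | add p q hp hq => simp [hp, hq]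
  | monomial n g =>
    induction g using Polynomial.induction_on' with
    | add p q hp hq => simp only [map_add, coeff_add, hp, hq]
    | monomial m c =>
      rw [Bivariate.swap_monomial_monomial]
      simp only [coeff_monomial]
      split_ifs <;> simp_all [coeff_monomial]

/-- Exchanging the variables turns the degree in `x` into an outer degree, whose additivity over a
domain is then available. -/
lemma degX_eq_natDegree_swap (f : PolyXY K) : degX f = (Bivariate.swap f).natDegree := by
  refine le_antisymm (degX_le_iff.2 fun j => ?_) ?_
  · refine natDegree_le_iff_coeff_eq_zero.2 fun i hi => ?_
    rw [← coeff_coeff_swap, coeff_eq_zero_of_natDegree_lt hi, coeff_zero]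
  · refine natDegree_le_iff_coeff_eq_zero.2 fun i hi => ?_
    ext j
    rw [coeff_coeff_swap, coeff_zero]
    exact coeff_eq_zero_of_natDegree_lt ((natDegree_coeff_le_degX f j).trans_lt hi)

lemma degX_mul {f g : PolyXY K} (hf : f ≠ 0) (hg : g ≠ 0) : degX (f * g) = degX f + degX g := by
  simp only [degX_eq_natDegree_swap, map_mul]
  exact natDegree_mul (by simpa using hf) (by simpa using hg)

lemma degX_le_of_dvd {f g : PolyXY K} (h : f ∣ g) (hg : g ≠ 0) : degX f ≤ degX g := by
  obtain ⟨k, rfl⟩ := h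
  rw [degX_mul (left_ne_zero_of_mul hg) (right_ne_zero_of_mul hg)]
  omega

lemma degX_mul_X_pow (f : PolyXY K) (j : ℕ) : degX (f * X ^ j) ≤ degX f := by
  refine degX_le_iff.2 fun i => ?_
  rw [coeff_mul_X_pow']
  split_ifs
  · exact natDegree_coeff_le_degX _ _
  · simp

/-! ### Translations -/

lemma eq_sum_sum_smul (f : PolyXY K) : f = ∑ j ∈ f.support, ∑ i ∈ (f.coeff j).support,
    ((f.coeff j).coeff i) • (varX ^ i * varY ^ j) := by
  conv_lhs => rw [f.as_sum_support_C_mul_X_pow]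
  refine Finset.sum_congr rfl fun j _ => ?_
  conv_lhs => rw [(f.coeff j).as_sum_support_C_mul_X_pow]
  rw [map_sum, Finset.sum_mul]
  refine Finset.sum_congr rfl fun i _ => ?_
  simp only [varX, varY, map_mul, map_pow, Algebra.smul_def, mul_assoc]
  rfl

/-- A `K`-algebra map is determined by the images of `x` and `y`; substituting polynomials of total
degree at most one cannot raise the total degree of a monomial. -/
lemma algHom_mem_totalDegLE (φ : PolyXY K →ₐ[K] PolyXY K) (hx : φ varX ∈ totalDegLE K 1)
    (hy : φ varY ∈ totalDegLE K 1) {f : PolyXY K} {T : ℕ} (hf : f ∈ totalDegLE K T) :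
    φ f ∈ totalDegLE K T := by
  rw [eq_sum_sum_smul f, map_sum]
  refine Submodule.sum_mem _ fun j _ => ?_
  rw [map_sum]
  refine Submodule.sum_mem _ fun i hi => ?_
  rw [map_smul, map_mul, map_pow, map_pow]
  refine Submodule.smul_mem _ _ (totalDegLE_mono ?_
    (mul_mem_totalDegLE (pow_mem_totalDegLE hx i) (pow_mem_totalDegLE hy j)))
  by_contra! h
  exact mem_support_iff.1 hi (hf i j (by omega))

lemma natDegree_algHom_le (φ : PolyXY K →ₐ[K] PolyXY K) (hx : (φ varX).natDegree = 0)
    (hy : (φ varY).natDegree ≤ 1) (f : PolyXY K) : (φ f).natDegree ≤ f.natDegree := by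
  conv_lhs => rw [eq_sum_sum_smul f, map_sum]
  refine natDegree_sum_le_of_forall_le _ _ fun j hj => ?_
  rw [map_sum]
  refine natDegree_sum_le_of_forall_le _ _ fun i _ => ?_
  rw [map_smul, map_mul, map_pow, map_pow]
  refine (natDegree_smul_le _ _).trans (natDegree_mul_le.trans ?_)
  have h1 : ((φ varX) ^ i).natDegree ≤ i * 0 := natDegree_pow_le_of_le i hx.le
  have h2 : ((φ varY) ^ j).natDegree ≤ j * 1 := natDegree_pow_le_of_le j hy
  have := le_natDegree_of_mem_supp j hj
  omega

/-! ### A dimension count -/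

/-- If the coefficients of the `G s` fit in a prescribed shape with fewer entries than there are
unknown coefficients of the multipliers `c s`, then the `G s` satisfy a nontrivial relation. -/
lemma exists_relation {ι : Type*} [Fintype ι] (G : ι → PolyXY K) (t : ι → ℕ) (n : ℕ) (T : ℕ → ℕ)
    (h : ∀ s j, (G s).coeff j ≠ 0 → j < n ∧ ((G s).coeff j).natDegree + t s ≤ T j)
    (hcard : ∑ j ∈ Finset.range n, T j < ∑ s, t s) :
    ∃ c : ι → K[X], c ≠ 0 ∧ (∀ s, c s ∈ degreeLT K (t s)) ∧ ∑ s, C (c s) * G s = 0 := by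
  classical
  have hfin : ∀ m, Module.finrank K (degreeLT K m) = m := fun m => by
    rw [(degreeLTEquiv K m).finrank_eq, Module.finrank_fin_fun]
  have : ∀ m, FiniteDimensional K (degreeLT K m) := fun m =>
    (degreeLTEquiv K m).symm.finiteDimensional
  -- `Φ` reads off the coefficients of `∑ c_s G_s` at `x^i y^j` for `j < n`, `i < T j`. Its source
  -- has larger dimension than its target, and the other coefficients vanish for degree reasons.
  let Φ : ((s : ι) → degreeLT K (t s)) →ₗ[K] ((j : Fin n) → Fin (T j) → K) :=
    LinearMap.pi fun j => LinearMap.pi fun i => ∑ s : ι,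
      lcoeff K i ∘ₗ LinearMap.mulRight K ((G s).coeff j) ∘ₗ (degreeLT K (t s)).subtype ∘ₗ
        LinearMap.proj s
  have hΦ : ∀ w j i, Φ w j i = ((∑ s, C (w s : K[X]) * G s).coeff j).coeff i := by
    intro w j i
    simp [Φ, coeff_C_mul]
  have hlt : Module.finrank K ((j : Fin n) → Fin (T j) → K) <
      Module.finrank K ((s : ι) → degreeLT K (t s)) := by
    rw [Module.finrank_pi_fintype, Module.finrank_pi_fintype]
    simpa [hfin, Finset.sum_range] using hcard
  obtain ⟨w, hw, hw0⟩ := Submodule.exists_mem_ne_zero_of_ne_bot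
    (LinearMap.ker_ne_bot_of_finrank_lt (f := Φ) hlt)
  refine ⟨fun s => w s, ?_, fun s => (w s).2, ?_⟩
  · intro h0
    exact hw0 (funext fun s => Subtype.ext (congrFun h0 s))
  · ext j i
    rw [coeff_zero, coeff_zero]
    by_cases hij : j < n ∧ i < T j
    · rw [← hΦ w ⟨j, hij.1⟩ ⟨i, hij.2⟩, LinearMap.mem_ker.1 hw]
      rfl
    · rw [finsetSum_coeff, finsetSum_coeff]
      refine Finset.sum_eq_zero fun s _ => ?_
      rw [coeff_C_mul]
      by_cases hG : (G s).coeff j = 0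
      · simp [hG]
      by_cases hws : (w s : K[X]) = 0
      · simp [hws]
      obtain ⟨h1, h2⟩ := h s j hG
      have h3 : (w s : K[X]).natDegree < t s := by
        rw [natDegree_lt_iff_degree_lt hws]
        exact mem_degreeLT.1 (w s).2
      refine coeff_eq_zero_of_natDegree_lt ((natDegree_mul_le (p := (w s : K[X]))).trans_lt ?_)
      have : ¬ i < T j := fun hi => hij ⟨h1, hi⟩
      omega

/-! ### Operators with prescribed coefficients -/

lemma exists_recOp {ρ : ℕ} (c : Fin (ρ + 1) → K[X]) : ∃ L : RecOp K,
    (∀ ℓ : Fin (ρ + 1), SkewPolynomial.coeff L ℓ = c ℓ) ∧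
      ∀ n, ρ < n → SkewPolynomial.coeff L n = 0 := by
  have key : ∀ n, SkewPolynomial.coeff (∑ ℓ : Fin (ρ + 1), SkewPolynomial.monomial (ℓ : ℕ) (c ℓ)) n
      = ∑ ℓ : Fin (ρ + 1), if (ℓ : ℕ) = n then c ℓ else 0 := by
    intro n
    let φ : RecOp K →+ K[X] :=
      { toFun := fun L => SkewPolynomial.coeff L n
        map_zero' := rfl
        map_add' := fun f g => by simp [SkewPolynomial.coeff] }
    exact (map_sum φ _ _).trans (Finset.sum_congr rfl fun ℓ _ => SkewPolynomial.coeff_monomial)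
  refine ⟨_, fun ℓ => (key ℓ).trans ?_, fun n hn => (key n).trans ?_⟩
  · simp [Fin.val_inj]
  · exact Finset.sum_eq_zero fun ℓ _ => if_neg (by omega)

lemma RecOp.app_eq_sum {ρ : ℕ} (L : RecOp K) (hL : ∀ n, ρ < n → SkewPolynomial.coeff L n = 0)
    (f : RatXY K) : L.app f = ∑ ℓ : Fin (ρ + 1),
      algebraMap (PolyXY K) (RatXY K) (C (SkewPolynomial.coeff L ℓ)) *
        (ratSigmaX ^ (ℓ : ℕ)) f := by
  rw [RecOp.app, Fin.sum_univ_eq_sum_range (fun ℓ => algebraMap (PolyXY K) (RatXY K)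
    (C (SkewPolynomial.coeff L ℓ)) * (ratSigmaX ^ ℓ) f)]
  refine Finset.sum_subset (fun n hn => ?_) fun n _ hn => ?_
  · rw [SkewPolynomial.mem_support_iff] at hn
    rw [Finset.mem_range]
    by_contra! h
    exact hn (hL n (by omega))
  · rw [SkewPolynomial.notMem_support_iff.1 hn]
    simp

/-! ### Powers of the shifts -/

lemma zpow_apply_eq_add {A : Type*} [CommRing A] [Algebra K A] (σ : A ≃ₐ[K] A) {v : A}
    (h : σ v = v + 1) (k : ℤ) : (σ ^ k) v = v + k := by
  have h' : σ⁻¹ v = v - 1 := by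
    rw [AlgEquiv.aut_inv, AlgEquiv.symm_apply_eq, map_sub, map_one, h, add_sub_cancel_right]
  induction k using Int.induction_on with
  | zero => simp
  | succ n ih => rw [zpow_add_one, AlgEquiv.mul_apply, h, map_add, map_one, ih]; push_cast; ring
  | pred n ih => rw [zpow_sub_one, AlgEquiv.mul_apply, h', map_sub, map_one, ih]; push_cast; ring

lemma zpow_apply_eq_self {A : Type*} [CommRing A] [Algebra K A] (σ : A ≃ₐ[K] A) {v : A}
    (h : σ v = v) (k : ℤ) : (σ ^ k) v = v := by
  have h' : σ⁻¹ v = v := by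
    rw [AlgEquiv.aut_inv, AlgEquiv.symm_apply_eq, h]
  induction k using Int.induction_on with
  | zero => simp
  | succ n ih => rw [zpow_add_one, AlgEquiv.mul_apply, h, ih]
  | pred n ih => rw [zpow_sub_one, AlgEquiv.mul_apply, h', ih]

lemma sigmaY_zpow_C (t : ℤ) (c : K[X]) : (sigmaY ^ t) (C c) = C c :=
  zpow_apply_eq_self _ (taylor_C (1 : K[X]) c) t

lemma C_eq_aeval_varX (c : K[X]) : C c = aeval (varX : PolyXY K) c := by
  rw [varX]
  simpa using (aeval_algebraMap_apply (PolyXY K) (X : K[X]) c).symm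

lemma sigmaX_zpow_C (k : ℤ) (c : K[X]) : (sigmaX ^ k) (C c) = C (c.comp (X + (k : K[X]))) := by
  rw [C_eq_aeval_varX, C_eq_aeval_varX, aeval_comp]
  change ((sigmaX ^ k : PolyXY K ≃ₐ[K] PolyXY K) : PolyXY K →ₐ[K] PolyXY K) _ = _
  rw [← aeval_algHom_apply]
  congr 2
  simpa using zpow_apply_eq_add sigmaX (sigmaX_varX (K := K)) k

lemma natDegree_comp_add_intCast (k : ℤ) (c : K[X]) :
    (c.comp (X + (k : K[X]))).natDegree = c.natDegree := by
  rw [natDegree_comp, ← C_eq_intCast, natDegree_X_add_C, mul_one]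

lemma ratSigmaX_pow_algebraMap (n : ℕ) (f : PolyXY K) :
    (ratSigmaX ^ n) (algebraMap (PolyXY K) (RatXY K) f) =
      algebraMap (PolyXY K) (RatXY K) ((sigmaX ^ (n : ℤ)) f) := by
  induction n generalizing f with
  | zero => simp
  | succ n ih =>
    rw [pow_succ, RingAut.mul_apply, ratSigmaX_algebraMap, ih, Nat.cast_succ, zpow_add_one,
      AlgEquiv.mul_apply]

lemma ratSigmaY_zpow_algebraMap (t : ℤ) (f : PolyXY K) :
    (ratSigmaY ^ t) (algebraMap (PolyXY K) (RatXY K) f) =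
      algebraMap (PolyXY K) (RatXY K) ((sigmaY ^ t) f) := by
  have hinv : ∀ f : PolyXY K, ratSigmaY⁻¹ (algebraMap (PolyXY K) (RatXY K) f) =
      algebraMap (PolyXY K) (RatXY K) (sigmaY⁻¹ f) := by
    intro f
    rw [RingAut.inv_apply, RingEquiv.symm_apply_eq, ratSigmaY_algebraMap, AlgEquiv.aut_inv,
      AlgEquiv.apply_symm_apply]
  induction t using Int.induction_on generalizing f with
  | zero => simp
  | succ n ih =>
    rw [zpow_add_one, RingAut.mul_apply, ratSigmaY_algebraMap, ih, zpow_add_one,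
      AlgEquiv.mul_apply]
  | pred n ih =>
    rw [zpow_sub_one, RingAut.mul_apply, hinv, ih, zpow_sub_one, AlgEquiv.mul_apply]

/-! ### Summable rational functions -/

lemma isSummable_zero : IsSummable (0 : RatXY K) := ⟨0, by simp⟩

lemma IsSummable.add {f g : RatXY K} (hf : IsSummable f) (hg : IsSummable g) :
    IsSummable (f + g) := by
  obtain ⟨f', rfl⟩ := hf
  obtain ⟨g', rfl⟩ := hg
  exact ⟨f' + g', by rw [map_add]; ring⟩

lemma isSummable_sum {ι : Type*} (s : Finset ι) {f : ι → RatXY K}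
    (h : ∀ i ∈ s, IsSummable (f i)) : IsSummable (∑ i ∈ s, f i) :=
  Finset.sum_induction _ _ (fun _ _ => IsSummable.add) isSummable_zero h

/-- A telescoping sum, in either direction. It allows every term to be moved by its own power of
`σ_y`. -/
lemma isSummable_sub_zpow (f : RatXY K) (t : ℤ) : IsSummable (f - (ratSigmaY ^ t) f) := by
  induction t using Int.induction_on with
  | zero => simpa using isSummable_zero
  | succ n ih =>
    have h : f - (ratSigmaY ^ ((n : ℤ) + 1)) f = (f - (ratSigmaY ^ (n : ℤ)) f) +
        (ratSigmaY (-(ratSigmaY ^ (n : ℤ)) f) - -(ratSigmaY ^ (n : ℤ)) f) := by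
      rw [add_comm (n : ℤ), zpow_one_add, RingAut.mul_apply, map_neg]
      ring
    rw [h]
    exact ih.add ⟨_, rfl⟩
  | pred n ih =>
    have h : f - (ratSigmaY ^ (-(n : ℤ) - 1)) f = (f - (ratSigmaY ^ (-(n : ℤ))) f) +
        (ratSigmaY ((ratSigmaY ^ (-(n : ℤ) - 1)) f) - (ratSigmaY ^ (-(n : ℤ) - 1)) f) := by
      rw [← RingAut.mul_apply, ← zpow_one_add, add_sub_cancel]
      ring
    rw [h]
    exact ih.add ⟨_, rfl⟩

/-! ### The polynomials `p(l x + m y + s)` -/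

lemma substLin_mem_totalDegLE (p : K[X]) (l m s : ℤ) :
    substLin p l m s ∈ totalDegLE K p.natDegree := by
  refine aeval_mem_totalDegLE (Submodule.add_mem _ (Submodule.add_mem _ ?_ ?_)
    (intCast_mem_totalDegLE _ _)) p
  · simpa using mul_mem_totalDegLE (intCast_mem_totalDegLE l 0) varX_mem_totalDegLE
  · simpa using mul_mem_totalDegLE (intCast_mem_totalDegLE m 0) varY_mem_totalDegLE

/-- In characteristic zero the integer `m` stays nonzero, so the linear form has degree exactly one
in `y`. -/
lemma natDegree_substLin [CharZero K] (p : K[X]) (l : ℤ) {m : ℤ} (hm : m ≠ 0) (s : ℤ) :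
    (substLin p l m s).natDegree = p.natDegree := by
  have hw : ((l : PolyXY K) * varX + (m : PolyXY K) * varY + (s : PolyXY K)) =
      C (m : K[X]) * X + C ((l : K[X]) * X + (s : K[X])) := by
    simp only [varX, varY, map_add, map_mul, map_intCast]
    ring
  have hp : substLin p l m s =
      (p.map (C : K →+* K[X])).comp (C (m : K[X]) * X + C ((l : K[X]) * X + (s : K[X]))) := by
    rw [substLin, hw, comp, eval₂_map]
    rfl
  rw [hp, natDegree_comp, natDegree_map_eq_of_injective C_injective,
    natDegree_linear (Int.cast_ne_zero.2 hm), mul_one]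

lemma algHom_substLin (φ : PolyXY K →ₐ[K] PolyXY K) {k t : ℤ} (hx : φ varX = varX + (k : PolyXY K))
    (hy : φ varY = varY + (t : PolyXY K)) (p : K[X]) (l m s : ℤ) :
    φ (substLin p l m s) = substLin p l m (s + l * k + m * t) := by
  rw [substLin, ← aeval_algHom_apply, substLin]
  congr 2
  simp only [map_add, map_mul, map_intCast, hx, hy]
  push_cast
  ring

lemma sigmaX_zpow_substLin (k : ℤ) (p : K[X]) (l m s : ℤ) :
    (sigmaX ^ k) (substLin p l m s) = substLin p l m (s + l * k) := by
  simpa using algHom_substLin ((sigmaX ^ k : PolyXY K ≃ₐ[K] PolyXY K) : PolyXY K →ₐ[K] PolyXY K)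
    (k := k) (t := 0) (zpow_apply_eq_add _ sigmaX_varX k)
    (by simpa using zpow_apply_eq_self _ (sigmaX_varY (K := K)) k) p l m s

lemma sigmaY_zpow_substLin (t : ℤ) (p : K[X]) (l m s : ℤ) :
    (sigmaY ^ t) (substLin p l m s) = substLin p l m (s + m * t) := by
  simpa using algHom_substLin ((sigmaY ^ t : PolyXY K ≃ₐ[K] PolyXY K) : PolyXY K →ₐ[K] PolyXY K)
    (k := 0) (t := t) (by simpa using zpow_apply_eq_self _ (sigmaY_varX (K := K)) t)
    (zpow_apply_eq_add _ sigmaY_varY t) p l m s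

/-- The translation `σ_y^t σ_x^k`. -/
noncomputable def translate (k t : ℤ) : PolyXY K ≃ₐ[K] PolyXY K := sigmaY ^ t * sigmaX ^ k

lemma translate_varX (k t : ℤ) : translate k t (varX : PolyXY K) = varX + (k : PolyXY K) := by
  rw [translate, AlgEquiv.mul_apply, zpow_apply_eq_add _ sigmaX_varX, map_add, map_intCast,
    zpow_apply_eq_self _ sigmaY_varX]

lemma translate_varY (k t : ℤ) : translate k t (varY : PolyXY K) = varY + (t : PolyXY K) := by
  rw [translate, AlgEquiv.mul_apply, zpow_apply_eq_self _ sigmaX_varY,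
    zpow_apply_eq_add _ sigmaY_varY]

lemma translate_mem_totalDegLE (k t : ℤ) {f : PolyXY K} {T : ℕ} (hf : f ∈ totalDegLE K T) :
    translate k t f ∈ totalDegLE K T := by
  refine algHom_mem_totalDegLE
    ((translate k t : PolyXY K ≃ₐ[K] PolyXY K) : PolyXY K →ₐ[K] PolyXY K) ?_ ?_ hf
  · change translate k t varX ∈ _
    rw [translate_varX]
    exact Submodule.add_mem _ varX_mem_totalDegLE (intCast_mem_totalDegLE _ _)
  · change translate k t varY ∈ _
    rw [translate_varY]
    exact Submodule.add_mem _ varY_mem_totalDegLE (intCast_mem_totalDegLE _ _)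

lemma natDegree_translate_le (k t : ℤ) (f : PolyXY K) :
    (translate k t f).natDegree ≤ f.natDegree := by
  refine natDegree_algHom_le
    ((translate k t : PolyXY K ≃ₐ[K] PolyXY K) : PolyXY K →ₐ[K] PolyXY K) ?_ ?_ f
  · change (translate k t varX).natDegree = 0
    rw [translate_varX, varX, ← C_eq_intCast, ← C_add, natDegree_C]
  · change (translate k t varY).natDegree ≤ 1
    rw [translate_varY, varY, ← C_eq_intCast, natDegree_X_add_C]

/-! ### Coprimality over `K(x)` -/

variable (K) in
/-- The inclusion of `K[x][y]` in `K(x)[y]`. -/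
noncomputable def toRatX : PolyXY K →+* (FractionRing K[X])[X] :=
  mapRingHom (algebraMap K[X] (FractionRing K[X]))

lemma toRatX_injective : Function.Injective (toRatX K) :=
  map_injective _ (IsFractionRing.injective K[X] (FractionRing K[X]))

lemma degree_toRatX (f : PolyXY K) : (toRatX K f).degree = f.degree :=
  degree_map_eq_of_injective (IsFractionRing.injective K[X] (FractionRing K[X])) f

/-- A nonzero element of `K[x]` becomes a unit in `K(x)[y]`, so a Bézout identity up to such an
element suffices. -/
lemma isCoprime_toRatX_of_C_mem {f g : PolyXY K} {d : K[X]} (hd : d ≠ 0)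
    (h : C d ∈ Ideal.span {f, g}) : IsCoprime (toRatX K f) (toRatX K g) := by
  obtain ⟨u, v, huv⟩ := Ideal.mem_span_pair.1 h
  have hd' : algebraMap K[X] (FractionRing K[X]) d ≠ 0 :=
    (map_ne_zero_iff _ (IsFractionRing.injective K[X] (FractionRing K[X]))).2 hd
  have huv' := congrArg (toRatX K) huv
  rw [map_add, map_mul, map_mul, show toRatX K (C d) = C (algebraMap K[X] (FractionRing K[X]) d)
    from map_C _] at huv'
  refine ⟨C (algebraMap K[X] (FractionRing K[X]) d)⁻¹ * toRatX K u,
    C (algebraMap K[X] (FractionRing K[X]) d)⁻¹ * toRatX K v, ?_⟩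
  rw [mul_assoc, mul_assoc, ← mul_add, huv', ← C_mul, inv_mul_cancel₀ hd', C_1]

/-- If the two linear forms are independent, then `x` is integral over `K` modulo
`p(l x + m y + s)` and `q(l' x + m' y + s')`. -/
lemma exists_C_mem_of_det_ne_zero [CharZero K] {p q : K[X]} (hp : p.Monic) (hq : q.Monic)
    {l m l' m' : ℤ} (hdet : l * m' - l' * m ≠ 0) {s s' : ℤ} {A : Type*} [CommRing A] [Algebra K A]
    (φ : PolyXY K →ₐ[K] A) (h : φ (substLin p l m s) = 0) (h' : φ (substLin q l' m' s') = 0) :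
    ∃ d : K[X], d ≠ 0 ∧ φ (C d) = 0 := by
  have h1 : IsIntegral K (φ
      ((l : PolyXY K) * varX + (m : PolyXY K) * varY + (s : PolyXY K))) := by
    refine ⟨p, hp, ?_⟩
    rw [← aeval_def]
    exact (aeval_algHom_apply φ _ p).trans h
  have h2 : IsIntegral K (φ
      ((l' : PolyXY K) * varX + (m' : PolyXY K) * varY + (s' : PolyXY K))) := by
    refine ⟨q, hq, ?_⟩
    rw [← aeval_def]
    exact (aeval_algHom_apply φ _ q).trans h'
  have hint : ∀ n : ℤ, IsIntegral K (n : A) := fun n => by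
    simpa using isIntegral_algebraMap (R := K) (A := A) (x := (n : K))
  -- Cramer's rule: `m'(lx + my) - m(l'x + m'y) = (lm' - l'm)x`.
  have h3 : IsIntegral K (((l * m' - l' * m : ℤ) : K) • φ varX) := by
    have := ((hint m').mul (h1.sub (hint s))).sub ((hint m).mul (h2.sub (hint s')))
    convert this using 1
    simp only [map_add, map_mul, map_intCast, Algebra.smul_def]
    push_cast
    ring
  have hdet' : ((l * m' - l' * m : ℤ) : K) ≠ 0 := Int.cast_ne_zero.2 hdet
  have h4 : IsIntegral K (φ varX) := by
    have := h3.smul (((l * m' - l' * m : ℤ) : K)⁻¹)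
    rwa [smul_smul, inv_mul_cancel₀ hdet', one_smul] at this
  obtain ⟨f, hf, hf0⟩ := h4
  refine ⟨f, hf.ne_zero, ?_⟩
  rw [← aeval_def] at hf0
  rw [C_eq_aeval_varX]
  exact (aeval_algHom_apply φ _ f).symm.trans hf0

lemma isCoprime_substLin_of_det_ne_zero [CharZero K] {p q : K[X]} (hp : p.Monic) (hq : q.Monic)
    {l m l' m' : ℤ} (hdet : l * m' - l' * m ≠ 0) (s s' : ℤ) :
    IsCoprime (toRatX K (substLin p l m s)) (toRatX K (substLin q l' m' s')) := by
  set S : Set (PolyXY K) := {substLin p l m s, substLin q l' m' s'} with hS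
  have hmem : ∀ f ∈ S, Ideal.Quotient.mkₐ K (Ideal.span S) f = 0 := fun f hf =>
    Ideal.Quotient.eq_zero_iff_mem.2 (Ideal.subset_span hf)
  obtain ⟨d, hd, hd0⟩ := exists_C_mem_of_det_ne_zero hp hq hdet
    (A := PolyXY K ⧸ Ideal.span S) (s := s) (s' := s') (Ideal.Quotient.mkₐ K (Ideal.span S))
    (hmem (substLin p l m s) (by simp [hS]))
    (hmem (substLin q l' m' s') (by simp [hS]))
  exact isCoprime_toRatX_of_C_mem hd (Ideal.Quotient.eq_zero_iff_mem.1 hd0)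

lemma substLin_eq_aeval_comp (p : K[X]) (l m s : ℤ) : substLin p l m s =
    aeval ((l : PolyXY K) * varX + (m : PolyXY K) * varY) (p.comp (X + (s : K[X]))) := by
  simp [substLin, aeval_comp]

lemma comp_add_intCast (p : K[X]) (s t : ℤ) :
    (p.comp (X + (s : K[X]))).comp (X + (t : K[X])) = p.comp (X + ((s + t : ℤ) : K[X])) := by
  rw [comp_assoc]
  congr 1
  simp only [add_comp, X_comp, intCast_comp]
  push_cast
  ring

lemma comp_add_intCast_monic {p : K[X]} (hp : p.Monic) (s : ℤ) :
    (p.comp (X + (s : K[X]))).Monic := by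
  rw [← C_eq_intCast]
  exact hp.comp_X_add_C _

lemma comp_add_intCast_irreducible {p : K[X]} (hp : Irreducible p) (s : ℤ) :
    Irreducible (p.comp (X + (s : K[X]))) := by
  have h := (MulEquiv.irreducible_iff (taylorEquiv (s : K)) (x := p)).2 hp
  have h1 : taylorEquiv (s : K) p = p.comp (X + C (s : K)) := taylor_apply (s : K) p
  rwa [h1, map_intCast] at h

/-- Two polynomials `p(l x + m y + s)` and `q(l' x + m' y + s')` of integer-linear type are coprime
over `K(x)` unless they agree. -/
lemma isCoprime_substLin_or [CharZero K] {p q : K[X]} (hp : p.Monic) (hq : q.Monic)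
    (hp' : Irreducible p) (hq' : Irreducible q) {l m l' m' : ℤ} (hlm : Int.gcd l m = 1)
    (hlm' : Int.gcd l' m' = 1) (hm : 0 < m) (hm' : 0 < m') (s s' : ℤ) :
    IsCoprime (toRatX K (substLin p l m s)) (toRatX K (substLin q l' m' s')) ∨
      l = l' ∧ m = m' ∧ p.comp (X + (s : K[X])) = q.comp (X + (s' : K[X])) := by
  by_cases hdet : l * m' - l' * m = 0
  · have hmm : m = m' := by
      refine Int.dvd_antisymm hm.le hm'.le ?_ ?_
      · exact (Int.isCoprime_iff_gcd_eq_one.2 hlm).symm.dvd_of_dvd_mul_left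
          ⟨l', by linarith⟩
      · exact (Int.isCoprime_iff_gcd_eq_one.2 hlm').symm.dvd_of_dvd_mul_left
          ⟨l, by linarith⟩
    subst hmm
    have hll : l = l' := by
      refine mul_right_cancel₀ hm.ne' ?_
      linarith
    subst hll
    by_cases heq : p.comp (X + (s : K[X])) = q.comp (X + (s' : K[X]))
    · exact Or.inr ⟨rfl, rfl, heq⟩
    · left
      have hcop : IsCoprime (p.comp (X + (s : K[X]))) (q.comp (X + (s' : K[X]))) := by
        rw [(comp_add_intCast_irreducible hp' s).coprime_iff_not_dvd]
        intro hdvd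
        exact heq (eq_of_monic_of_associated (comp_add_intCast_monic hp s)
          (comp_add_intCast_monic hq s') ((comp_add_intCast_irreducible hp' s).associated_of_dvd
            (comp_add_intCast_irreducible hq' s') hdvd))
      rw [substLin_eq_aeval_comp, substLin_eq_aeval_comp]
      exact (hcop.map (aeval ((l : PolyXY K) * varX + (m : PolyXY K) * varY)).toRingHom).map
        (toRatX K)
  · exact Or.inl (isCoprime_substLin_of_det_ne_zero hp hq hdet s s')

/-- A nonzero period would make `p` take the value `p(0)` at infinitely many points in
characteristic zero, hence be constant. -/
lemma eq_zero_of_comp_add_intCast_eq_self [CharZero K] {p : K[X]} (hp : Irreducible p) {s : ℤ}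
    (h : p.comp (X + (s : K[X])) = p) : s = 0 := by
  by_contra hs
  have heval : ∀ n : ℕ, p.eval ((n : K) * s) = p.eval 0 := by
    intro n
    induction n with
    | zero => simp
    | succ n ih =>
      rw [← ih]
      conv_rhs => rw [← h]
      rw [eval_comp, eval_add, eval_X, eval_intCast]
      push_cast
      ring_nf
  have hconst : p = C (p.eval 0) := by
    refine eq_of_infinite_eval_eq _ _ (Set.Infinite.mono ?_ (Set.infinite_range_of_injective
      (f := fun n : ℕ => (n : K) * s) fun a b hab => ?_))
    · rintro _ ⟨n, rfl⟩
      simpa using heval n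
    · exact Nat.cast_injective (mul_right_cancel₀ (Int.cast_ne_zero.2 hs) hab)
  have := hp.natDegree_pos
  rw [hconst, natDegree_C] at this
  exact this.false

/-- For different `i`, failure of coprimality would make the two factors integer translates of one
another and so contradict inequivalence. For the same `i`, it would give `p_i` the nonzero period
`ν_ij - ν_ij'`. -/
lemma RefinedILD.isCoprime_toRatX [CharZero K] {g : PolyXY K} (D : RefinedILD g)
    {w w' : Σ i, Fin (D.n i)} (h : w ≠ w') :
    IsCoprime (toRatX K (substLin (D.p w.1) (D.lam w.1) (D.mu w.1) (D.nu w.1 w.2)))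
      (toRatX K (substLin (D.p w'.1) (D.lam w'.1) (D.mu w'.1) (D.nu w'.1 w'.2))) := by
  have hlt : ∀ w w' : Σ i, Fin (D.n i), w.1 < w'.1 →
      IsCoprime (toRatX K (substLin (D.p w.1) (D.lam w.1) (D.mu w.1) (D.nu w.1 w.2)))
      (toRatX K (substLin (D.p w'.1) (D.lam w'.1) (D.mu w'.1) (D.nu w'.1 w'.2))) := by
    intro w w' hww
    refine (isCoprime_substLin_or (D.p_monic _) (D.p_monic _) (D.p_irreducible _)
      (D.p_irreducible _) (D.coprime _) (D.coprime _) (D.mu_pos _) (D.mu_pos _) _ _).resolve_right ?_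
    rintro ⟨hl, hm, hpq⟩
    refine D.not_shiftEquiv _ _ hww ?_
    -- From `λa + μb = 1`, the shift of the argument by `δ` is realised by `σ_x^(aδ) σ_y^(bδ)`.
    have hgcd := Int.gcd_eq_gcd_ab (D.lam w'.1) (D.mu w'.1)
    rw [D.coprime] at hgcd
    set a := Int.gcdA (D.lam w'.1) (D.mu w'.1)
    set b := Int.gcdB (D.lam w'.1) (D.mu w'.1)
    set δ : ℤ := D.nu w'.1 w'.2 - D.nu w.1 w.2 with hδ
    refine ⟨a * δ, b * δ, ?_⟩
    rw [sigmaY_zpow_substLin, sigmaX_zpow_substLin, hl, hm, substLin_eq_aeval_comp,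
      substLin_eq_aeval_comp]
    have h1 := congrArg (fun f => f.comp (X + ((-(D.nu w.1 w.2) : ℤ) : K[X]))) hpq
    simp only [comp_add_intCast] at h1
    rw [add_neg_cancel] at h1
    rw [h1]
    congr 4
    push_cast at hgcd
    linear_combination δ * hgcd
  rcases lt_trichotomy w.1 w'.1 with h1 | h1 | h1
  · exact hlt _ _ h1
  · obtain ⟨i, j⟩ := w
    obtain ⟨i', j'⟩ := w'
    obtain rfl : i = i' := h1
    refine (isCoprime_substLin_or (D.p_monic _) (D.p_monic _) (D.p_irreducible _)
      (D.p_irreducible _) (D.coprime _) (D.coprime _) (D.mu_pos _) (D.mu_pos _) _ _).resolve_right ?_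
    rintro ⟨-, -, hpq⟩
    have h1 := congrArg (fun f => f.comp (X + ((-(D.nu i j') : ℤ) : K[X]))) hpq
    simp only [comp_add_intCast] at h1
    rw [add_neg_cancel, Int.cast_zero, add_zero, comp_X] at h1
    have h2 := eq_zero_of_comp_add_intCast_eq_self (D.p_irreducible i) h1
    have h3 : D.nu i j = D.nu i j' := by omega
    exact h (by rw [(D.nu_strictMono i).injective h3])
  · exact (hlt _ _ h1).symm

/-! ### Partial fractions -/

/-- Uniqueness of partial fractions: modulo `q k` only the `k`-th summand survives, its cofactor is
invertible there over `K(x)`, and the degree bound forces `A k = 0`. -/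
lemma eq_zero_of_sum_mul_prod_eq_zero {ι : Type*} [Fintype ι] [DecidableEq ι] {q A : ι → PolyXY K}
    (hq : Pairwise fun k k' => IsCoprime (toRatX K (q k)) (toRatX K (q k')))
    (hA : ∀ k, (A k).degree < (q k).degree)
    (h : ∑ k, A k * ∏ k' ∈ Finset.univ.erase k, q k' = 0) (k : ι) : A k = 0 := by
  have hdvd : q k ∣ A k * ∏ k' ∈ Finset.univ.erase k, q k' := by
    rw [← Finset.add_sum_erase _ _ (Finset.mem_univ k)] at h
    rw [eq_neg_of_add_eq_zero_left h]
    refine (dvd_neg (α := PolyXY K)).2 ?_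
    refine Finset.dvd_sum fun k' hk' => Dvd.dvd.mul_left (Finset.dvd_prod_of_mem _ ?_) _
    exact Finset.mem_erase.2 ⟨(Finset.ne_of_mem_erase hk').symm, Finset.mem_univ _⟩
  have hcop : IsCoprime (toRatX K (q k)) (toRatX K (∏ k' ∈ Finset.univ.erase k, q k')) := by
    rw [map_prod]
    exact IsCoprime.prod_right fun k' hk' => hq (Finset.ne_of_mem_erase hk').symm
  have hdvd' := map_dvd (toRatX K) hdvd
  rw [map_mul] at hdvd'
  refine toRatX_injective ((eq_zero_of_dvd_of_degree_lt (hcop.dvd_of_dvd_mul_right hdvd') ?_).trans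
    (map_zero _).symm)
  rw [degree_toRatX, degree_toRatX]
  exact hA k

lemma coeff_sum_fin_C_mul_X_pow {R : Type*} [Semiring R] {n : ℕ} (c : Fin n → R) (i : Fin n) :
    (∑ j : Fin n, C (c j) * X ^ (j : ℕ)).coeff i = c i := by
  simp [finsetSum_coeff, coeff_X_pow, Fin.val_inj]

lemma degX_sum_fin_le {n N : ℕ} {c : Fin n → K[X]} (h : ∀ j, (c j).natDegree ≤ N) :
    degX (∑ j : Fin n, C (c j) * X ^ (j : ℕ) : PolyXY K) ≤ N := by
  refine degX_le_iff.2 fun i => ?_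
  rw [finsetSum_coeff]
  refine natDegree_sum_le_of_forall_le _ _ fun j _ => ?_
  rw [coeff_C_mul_X_pow]
  split_ifs
  · exact h j
  · simp

/-- Partial fraction decomposition of `a / (v ∏ q k)` with respect to `y`, with bounds for the
degrees in `x`. -/
lemma exists_partialFractions {ι : Type*} [Fintype ι] [DecidableEq ι] {a b v : PolyXY K}
    {q : ι → PolyXY K} (hv : v.natDegree = 0) (hb : b = v * ∏ k, q k) (ha : a ≠ 0)
    (hab : a.degree < b.degree)
    (hq : Pairwise fun k k' => IsCoprime (toRatX K (q k)) (toRatX K (q k'))) :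
    ∃ (d : K[X]) (A : ι → PolyXY K), d ≠ 0 ∧ d.natDegree ≤ b.natDegree * degX b ∧
      (∀ k, (A k).degree < (q k).degree) ∧
      (∀ k, degX (A k) ≤ (b.natDegree - 1) * degX b + degX a) ∧
      C d * a = ∑ k, A k * (v * ∏ k' ∈ Finset.univ.erase k, q k') := by
  have hb0 : b ≠ 0 := ne_zero_of_degree_gt hab
  have hv0 : v ≠ 0 := fun h => hb0 (by rw [hb, h, zero_mul])
  have hq0 : ∀ k, q k ≠ 0 := fun k h => hb0 (by
    rw [hb, Finset.prod_eq_zero (Finset.mem_univ k) h, mul_zero])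
  have hnat : a.natDegree < b.natDegree := natDegree_lt_natDegree ha hab
  have hn : b.natDegree = ∑ k, (q k).natDegree := by
    rw [hb, natDegree_mul hv0 (Finset.prod_ne_zero_iff.2 fun k _ => hq0 k), hv, zero_add,
      natDegree_prod _ _ fun k _ => hq0 k]
  set cof : ι → PolyXY K := fun k => v * ∏ k' ∈ Finset.univ.erase k, q k' with hcof
  have hcof0 : ∀ k, cof k ≠ 0 := fun k =>
    mul_ne_zero hv0 (Finset.prod_ne_zero_iff.2 fun k _ => hq0 k)
  have hcofb : ∀ k, q k * cof k = b := fun k => by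
    rw [hb, ← Finset.mul_prod_erase _ _ (Finset.mem_univ k)]
    simp only [hcof]
    ring
  have hcofdeg : ∀ k, (q k).natDegree + (cof k).natDegree = b.natDegree := fun k => by
    rw [← hcofb k, natDegree_mul (hq0 k) (hcof0 k)]
  have hcofX : ∀ k, degX (cof k) ≤ degX b := fun k =>
    degX_le_of_dvd (Dvd.intro_left _ (hcofb k)) hb0
  obtain ⟨n, hn'⟩ : ∃ n, b.natDegree = n + 1 := ⟨b.natDegree - 1, by omega⟩
  -- The unknowns are `d` (index `none`) and the coefficients in `y` of the numerators, `n + 1` in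
  -- all since the degrees of the `q k` sum to `n + 1`. With `B = degX b`, there are `(n+1)B + 1 +
  -- (n+1)(nB + degX a + 1)` unknown scalars, exactly one more than the `(n+1)((n+1)B + degX a + 1)`
  -- equations.
  obtain ⟨c, hc0, hcdeg, hc⟩ := exists_relation (K := K)
    (ι := Option (Σ k, Fin (q k).natDegree))
    (fun o => o.elim a fun s => cof s.1 * X ^ (s.2 : ℕ))
    (fun o => o.elim ((n + 1) * degX b + 1) fun _ => n * degX b + degX a + 1)
    (n + 1) (fun _ => (n + 1) * degX b + degX a + 1)
    (by
      rintro (_ | ⟨k, i⟩) j hj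
      · have h1 := le_natDegree_of_ne_zero hj
        have h2 := natDegree_coeff_le_degX a j
        simp only [Option.elim_none] at h1 ⊢
        exact ⟨by omega, by omega⟩
      · have h1 := le_natDegree_of_ne_zero hj
        simp only [Option.elim_some] at h1 ⊢
        have h2 := (natDegree_coeff_le_degX (cof k * X ^ (i : ℕ)) j).trans
          ((degX_mul_X_pow _ _).trans (hcofX k))
        rw [natDegree_mul_X_pow _ (hcof0 k)] at h1
        have h3 := hcofdeg k
        have h4 := i.2
        refine ⟨by omega, ?_⟩
        rw [Nat.succ_mul]
        omega)
    (by
      rw [Fintype.sum_option]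
      simp only [Option.elim_none, Option.elim_some, Finset.sum_const, Finset.card_range,
        Finset.card_univ, Fintype.card_sigma, Fintype.card_fin, smul_eq_mul, ← hn, hn']
      nlinarith)
  rw [Fintype.sum_option, Fintype.sum_sigma] at hc
  simp only [Option.elim_none, Option.elim_some] at hc
  set P : ι → PolyXY K := fun k => ∑ j : Fin (q k).natDegree, C (c (some ⟨k, j⟩)) * X ^ (j : ℕ)
    with hP
  have hcP : C (c none) * a + ∑ k, P k * cof k = 0 := by
    rw [← hc]
    congr 1
    refine Finset.sum_congr rfl fun k _ => ?_
    rw [hP, Finset.sum_mul]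
    exact Finset.sum_congr rfl fun j _ => by ring
  have hPdeg : ∀ k, (P k).degree < (q k).degree := fun k => by
    rw [degree_eq_natDegree (hq0 k)]
    refine (degree_sum_le _ _).trans_lt ?_
    rw [Finset.sup_lt_iff (WithBot.bot_lt_coe _)]
    exact fun j _ => (degree_C_mul_X_pow_le _ _).trans_lt (by exact_mod_cast j.2)
  have hcle : ∀ o m, c o ∈ degreeLT K (m + 1) → (c o).natDegree ≤ m := fun o m h =>
    natDegree_le_iff_coeff_eq_zero.2 fun i hi =>
      coeff_eq_zero_of_degree_lt ((mem_degreeLT.1 h).trans_le (by exact_mod_cast hi))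
  -- With `d = 0` the relation would be a partial fraction decomposition of zero, so by uniqueness
  -- all unknowns would vanish.
  have hd : c none ≠ 0 := by
    intro h0
    rw [h0, C_0, zero_mul, zero_add] at hcP
    have hfac : v * ∑ k, P k * ∏ k' ∈ Finset.univ.erase k, q k' = 0 := by
      rw [← hcP, Finset.mul_sum]
      exact Finset.sum_congr rfl fun k _ => by simp only [hcof]; ring
    have hP0 := eq_zero_of_sum_mul_prod_eq_zero hq hPdeg ((mul_eq_zero.1 hfac).resolve_left hv0)
    refine hc0 (funext fun o => ?_)
    rcases o with _ | ⟨k, j⟩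
    · exact h0
    · have := coeff_sum_fin_C_mul_X_pow (fun j => c (some ⟨k, j⟩)) j
      rw [show (∑ j : Fin (q k).natDegree, C (c (some ⟨k, j⟩)) * X ^ (j : ℕ)) = P k from rfl,
        hP0 k] at this
      exact this.symm
  refine ⟨c none, fun k => -P k, hd, ?_, fun k => ?_, fun k => ?_, ?_⟩
  · rw [hn']
    exact hcle _ _ (hcdeg none)
  · rw [degree_neg]
    exact hPdeg k
  · rw [hn', Nat.add_sub_cancel]
    have : degX (-P k) = degX (P k) := by simp [degX]
    rw [this]
    exact degX_sum_fin_le fun j => hcle _ _ (hcdeg (some ⟨k, j⟩))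
  · rw [eq_neg_of_add_eq_zero_left hcP, ← Finset.sum_neg_distrib]
    exact Finset.sum_congr rfl fun k _ => by simp only [hcof]; ring

/-! ### Telescopers from relations between the remainders of the shifts -/

lemma ratSigmaY_zpow_ratSigmaX_pow_div (t : ℤ) (n : ℕ) (f g : PolyXY K) :
    (ratSigmaY ^ t) ((ratSigmaX ^ n) (algebraMap (PolyXY K) (RatXY K) f / algebraMap _ _ g)) =
      algebraMap (PolyXY K) (RatXY K) (translate n t f) / algebraMap _ _ (translate n t g) := by
  rw [map_div₀, map_div₀, ratSigmaX_pow_algebraMap, ratSigmaX_pow_algebraMap,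
    ratSigmaY_zpow_algebraMap, ratSigmaY_zpow_algebraMap]
  rfl

lemma translate_C (k t : ℤ) (c : K[X]) :
    translate k t (C c) = C (c.comp (X + (k : K[X]))) := by
  rw [translate, AlgEquiv.mul_apply, sigmaX_zpow_C, sigmaY_zpow_C]

/-- If the shifts of the denominators `q w` are moved by powers of `σ_y` to divisors of a common
denominator `B`, then a relation between the resulting numerators yields a telescoper. -/
lemma exists_telescoper_of_relation {ι : Type*} [Fintype ι] {r : RatXY K} {A q : ι → PolyXY K}
    {f : K[X]} (hf : f ≠ 0)
    (hr : r = ∑ w, algebraMap (PolyXY K) (RatXY K) (A w) / algebraMap _ _ (C f * q w))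
    {B : PolyXY K} (hB : B ≠ 0) {ρ : ℕ} {t : ℕ → ι → ℤ} {H : ℕ → ι → PolyXY K}
    (hH : ∀ ℓ w, H ℓ w * translate ℓ (t ℓ w) (q w) = B) {c : Fin (ρ + 1) → K[X]} (hc : c ≠ 0)
    (hrel : ∑ ℓ, C (c ℓ) * (C (∏ ℓ' ∈ Finset.univ.erase ℓ, f.comp (X + (((ℓ' : ℕ) : ℤ) : K[X]))) *
      ∑ w, translate ℓ (t ℓ w) (A w) * H ℓ w) = 0) :
    ∃ L : RecOp K, IsTelescoper L r ∧
      (∀ ℓ : Fin (ρ + 1), SkewPolynomial.coeff L ℓ = c ℓ) ∧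
      ∀ n, ρ < n → SkewPolynomial.coeff L n = 0 := by
  obtain ⟨L, hLc, hL0⟩ := exists_recOp c
  refine ⟨L, ⟨fun h0 => hc (funext fun ℓ => ?_), ?_⟩, hLc, hL0⟩
  · rw [← hLc ℓ, h0]
    rfl
  set α := algebraMap (PolyXY K) (RatXY K) with hα
  have hαinj : Function.Injective α := IsFractionRing.injective _ _
  set F : Fin (ρ + 1) → K[X] := fun ℓ => f.comp (X + (((ℓ : ℕ) : ℤ) : K[X])) with hF
  have hF0 : ∀ ℓ, F ℓ ≠ 0 := fun ℓ h0 => hf (by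
    have h1 := congrArg (fun g => g.comp (X + ((-((ℓ : ℕ) : ℤ) : ℤ) : K[X]))) h0
    simp only [hF, comp_add_intCast] at h1
    simpa using h1)
  set g : Fin (ρ + 1) → ι → RatXY K := fun ℓ w =>
    α (C (c ℓ)) * (ratSigmaX ^ (ℓ : ℕ)) (α (A w) / α (C f * q w)) with hg
  have happ : L.app r = ∑ ℓ, ∑ w, g ℓ w := by
    rw [RecOp.app_eq_sum L hL0, hr]
    refine Finset.sum_congr rfl fun ℓ _ => ?_
    rw [hLc, map_sum, Finset.mul_sum]
  -- After its move by `σ_y`, each term is written over the one denominator `(∏ F ℓ) B`; the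
  -- numerators are those of `hrel`.
  have hshift : ∀ (ℓ : Fin (ρ + 1)) (w : ι), (ratSigmaY ^ t ℓ w) (g ℓ w) = α (C (c ℓ) *
      (C (∏ ℓ' ∈ Finset.univ.erase ℓ, F ℓ') * (translate ℓ (t ℓ w) (A w) * H ℓ w))) /
        α (C (∏ ℓ, F ℓ) * B) := by
    intro ℓ w
    rw [hg, map_mul, ratSigmaY_zpow_algebraMap, sigmaY_zpow_C, ratSigmaY_zpow_ratSigmaX_pow_div,
      map_mul, translate_C]
    have h1 : C (F ℓ) * translate ℓ (t ℓ w) (q w) ≠ 0 :=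
      mul_ne_zero (C_ne_zero.2 (hF0 ℓ)) fun h0 => hB (by rw [← hH ℓ w, h0, mul_zero])
    have h2 : C (∏ ℓ, F ℓ) * B ≠ 0 :=
      mul_ne_zero (C_ne_zero.2 (Finset.prod_ne_zero_iff.2 fun ℓ _ => hF0 ℓ)) hB
    rw [mul_div_assoc', div_eq_div_iff ((map_ne_zero_iff α hαinj).2 h1)
      ((map_ne_zero_iff α hαinj).2 h2), ← hα, ← map_mul, ← map_mul, ← map_mul, ← hH ℓ w,
      ← Finset.mul_prod_erase _ F (Finset.mem_univ ℓ)]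
    refine congrArg α ?_
    rw [C_mul]
    change _ = _ * (C (F ℓ) * _)
    ring
  have hsum : ∑ ℓ : Fin (ρ + 1), ∑ w, (ratSigmaY ^ t ℓ w) (g ℓ w) = 0 := by
    simp only [hshift, ← Finset.sum_div, ← map_sum, ← Finset.mul_sum]
    rw [hrel, map_zero, zero_div]
  -- The moved terms sum to zero, so subtracting them exhibits `L(r)` as a sum of differences `h -
  -- σ_y^t(h)`.
  have hsplit : ∑ ℓ, ∑ w, g ℓ w = ∑ ℓ, ∑ w, (g ℓ w - (ratSigmaY ^ t ℓ w) (g ℓ w)) := by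
    simp only [Finset.sum_sub_distrib]
    rw [hsum, sub_zero]
  rw [happ, hsplit]
  exact isSummable_sum _ fun ℓ _ => isSummable_sum _ fun w _ => isSummable_sub_zpow _ _

/-! ### The common denominator of the remainders of the shifts -/

lemma exists_irreducible_dvd_of_natDegree_pos (f : PolyXY K) (hf : 0 < f.natDegree) :
    ∃ q : PolyXY K, Irreducible q ∧ q ∣ f ∧ 0 < q.natDegree := by
  induction f using WfDvdMonoid.induction_on_irreducible with
  | zero => simp at hf
  | unit u hu => exact absurd hf (natDegree_eq_zero_of_isUnit hu).not_gt
  | mul a i ha hi ih =>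
    by_cases h : 0 < i.natDegree
    · exact ⟨i, hi, Dvd.intro _ rfl, h⟩
    · rw [natDegree_mul hi.ne_zero ha] at hf
      obtain ⟨q, hq, hqa, hq0⟩ := ih (by omega)
      exact ⟨q, hq, Dvd.dvd.mul_left hqa i, hq0⟩

/-- An irreducible factor of `p₀` of positive degree in `y` would divide `g` and hence be
integer-linear, which the decomposition excludes. -/
lemma RefinedILD.natDegree_p₀ {g : PolyXY K} (D : RefinedILD g) (hg : IsIntegerLinear g) :
    D.p₀.natDegree = 0 := by
  by_contra h
  obtain ⟨q, hq, hqd, hq0⟩ := exists_irreducible_dvd_of_natDegree_pos D.p₀ (Nat.pos_of_ne_zero h)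
  refine D.not_integerLinear q hq hqd hq0 (hg q hq (hqd.trans ?_))
  exact Dvd.intro _ D.eq_prod.symm

/-- The maximal exponent `max_j e_ij`. -/
def RefinedILD.maxExp {g : PolyXY K} (D : RefinedILD g) (i : Fin D.m) : ℕ :=
  Finset.univ.sup (D.e i)

/-- The product `∏_i ∏_{0 ≤ κ < μ_i} p_i(λ_i x + μ_i y + κ)^(max_j e_ij)`. -/
noncomputable def RefinedILD.commonDenom {g : PolyXY K} (D : RefinedILD g) : PolyXY K :=
  ∏ w : Σ i, Fin (D.mu i).toNat,
    substLin (D.p w.1) (D.lam w.1) (D.mu w.1) (w.2 : ℕ) ^ D.maxExp w.1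

/-- `ρ₀` as a natural number. -/
noncomputable def RefinedILD.rhoNat {g : PolyXY K} (D : RefinedILD g) : ℕ :=
  ∑ w : Σ i, Fin (D.mu i).toNat, D.maxExp w.1 * (D.p w.1).natDegree

lemma RefinedILD.rho₀_eq {g : PolyXY K} (D : RefinedILD g) : D.rho₀ = (D.rhoNat : ℤ) := by
  rw [rho₀, rhoNat, Fintype.sum_sigma]
  push_cast
  refine Finset.sum_congr rfl fun i _ => ?_
  rw [Finset.sum_const, Finset.card_univ, Fintype.card_fin, nsmul_eq_mul,
    Int.natCast_toNat_eq_self.2 (D.mu_pos i).le, maxExp]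
  ring

lemma substLin_pow_mem_totalDegLE (p : K[X]) (l m s : ℤ) (e : ℕ) :
    substLin p l m s ^ e ∈ totalDegLE K (e * p.natDegree) :=
  pow_mem_totalDegLE (substLin_mem_totalDegLE p l m s) e

lemma substLin_ne_zero [CharZero K] {p : K[X]} (hp : Irreducible p) (l : ℤ) {m : ℤ} (hm : m ≠ 0)
    (s : ℤ) : substLin p l m s ≠ 0 := fun h => by
  have := natDegree_substLin p l hm s
  rw [h, natDegree_zero] at this
  exact hp.natDegree_pos.ne this

lemma RefinedILD.commonDenom_ne_zero [CharZero K] {g : PolyXY K} (D : RefinedILD g) :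
    D.commonDenom ≠ 0 :=
  Finset.prod_ne_zero_iff.2 fun _ _ =>
    pow_ne_zero _ (substLin_ne_zero (D.p_irreducible _) _ (D.mu_pos _).ne' _)

/-- Every `p_i(λ_i x + μ_i y + s)^e` with `e ≤ max_j e_ij` has a `σ_y`-shift that divides the common
denominator. -/
lemma RefinedILD.exists_cofactor {g : PolyXY K} (D : RefinedILD g) (i : Fin D.m) (s : ℤ) {e : ℕ}
    (he : e ≤ D.maxExp i) : e * (D.p i).natDegree ≤ D.rhoNat ∧
      ∃ (t : ℤ) (H : PolyXY K), H ∈ totalDegLE K (D.rhoNat - e * (D.p i).natDegree) ∧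
        H * substLin (D.p i) (D.lam i) (D.mu i) (s + D.mu i * t) ^ e = D.commonDenom := by
  classical
  -- Division of `s` by `μ_i`: the remainder selects the factor of the common denominator, and minus
  -- the quotient is the power of `σ_y`.
  have h0 := Int.emod_nonneg s (D.mu_pos i).ne'
  have h1 := Int.emod_lt_of_pos s (D.mu_pos i)
  obtain ⟨w, rfl, hw⟩ : ∃ w : Σ i, Fin (D.mu i).toNat, w.1 = i ∧ ((w.2 : ℕ) : ℤ) = s % D.mu i :=
    ⟨⟨i, (s % D.mu i).toNat, by omega⟩, rfl, Int.toNat_of_nonneg h0⟩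
  have hs : s + D.mu w.1 * -(s / D.mu w.1) = ((w.2 : ℕ) : ℤ) := by
    have h2 := Int.emod_add_mul_ediv s (D.mu w.1)
    rw [hw]
    linarith
  have hR : D.rhoNat = D.maxExp w.1 * (D.p w.1).natDegree +
      ∑ w ∈ Finset.univ.erase w, D.maxExp w.1 * (D.p w.1).natDegree :=
    (Finset.add_sum_erase _ _ (Finset.mem_univ w)).symm
  have hB : D.commonDenom = substLin (D.p w.1) (D.lam w.1) (D.mu w.1) (w.2 : ℕ) ^ D.maxExp w.1 *
      ∏ w ∈ Finset.univ.erase w,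
        substLin (D.p w.1) (D.lam w.1) (D.mu w.1) (w.2 : ℕ) ^ D.maxExp w.1 :=
    (Finset.mul_prod_erase _ _ (Finset.mem_univ w)).symm
  have hmul : e * (D.p w.1).natDegree + (D.maxExp w.1 - e) * (D.p w.1).natDegree =
      D.maxExp w.1 * (D.p w.1).natDegree := by
    rw [← add_mul, Nat.add_sub_cancel' he]
  refine ⟨by omega, -(s / D.mu w.1),
    substLin (D.p w.1) (D.lam w.1) (D.mu w.1) (w.2 : ℕ) ^ (D.maxExp w.1 - e) *
      ∏ w ∈ Finset.univ.erase w,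
        substLin (D.p w.1) (D.lam w.1) (D.mu w.1) (w.2 : ℕ) ^ D.maxExp w.1, ?_, ?_⟩
  · refine totalDegLE_mono ?_ (mul_mem_totalDegLE (substLin_pow_mem_totalDegLE _ _ _ _ _)
      (prod_mem_totalDegLE _ fun w _ => substLin_pow_mem_totalDegLE _ _ _ _ _))
    omega
  · rw [hs, hB]
    obtain ⟨k, hk⟩ := Nat.exists_eq_add_of_le he
    generalize D.maxExp w.1 = E at *
    subst hk
    rw [Nat.add_sub_cancel_left, pow_add]
    ring

lemma translate_substLin (k t : ℤ) (p : K[X]) (l m s : ℤ) :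
    translate k t (substLin p l m s) = substLin p l m (s + l * k + m * t) := by
  rw [translate, AlgEquiv.mul_apply, sigmaX_zpow_substLin, sigmaY_zpow_substLin]

/-! ### Counting -/

lemma two_mul_sum_range_sub {X R : ℕ} (h : R ≤ X) :
    2 * ((∑ j ∈ Finset.range R, (X - j) : ℕ) : ℚ) = 2 * X * R - R * (R - 1) := by
  induction R with
  | zero => simp
  | succ n ih =>
    rw [Finset.sum_range_succ, Nat.cast_add, mul_add, ih (by omega), Nat.cast_sub (by omega)]
    push_cast
    ring

/-- The sum equals `(τ + S + R)R - R(R-1)/2`. Comparing it with `(ρ+1)(τ+1)` and solving for `τ`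
means dividing by `ρ + 1 - R`, which is positive because `R ≤ ρ`. -/
lemma sum_range_lt_of_lt_div {ρ τ R S du da n B : ℕ} (hR : R ≤ ρ)
    (hS : S ≤ ρ * (du + n * B) + ((n - 1) * B + da))
    (hτ : (τ : ℚ) > ((((ρ : ℚ) + 1) * B * n + ρ * du + da + R) * R - 1 / 2 * R * ((R : ℚ) - 1)
      - ((ρ : ℚ) + 1)) / ((ρ : ℚ) + 1 - R)) :
    ∑ j ∈ Finset.range R, (τ + S + R - j) < (ρ + 1) * (τ + 1) := by
  have hpos : (0 : ℚ) < (ρ : ℚ) + 1 - R := by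
    have : (R : ℚ) ≤ ρ := by exact_mod_cast hR
    linarith
  rw [gt_iff_lt, div_lt_iff₀ hpos] at hτ
  -- Relaxing `(n - 1)B` to `nB` merges the contribution of the numerators with that of the
  -- denominators into `(ρ + 1)Bn`.
  have hS' : S ≤ (ρ + 1) * B * n + ρ * du + da := by
    have h1 : (n - 1) * B ≤ n * B := Nat.mul_le_mul_right _ (by omega)
    nlinarith
  have hSQ : (S : ℚ) ≤ (ρ + 1) * B * n + ρ * du + da := by exact_mod_cast hS'
  have hSR := mul_le_mul_of_nonneg_right hSQ (Nat.cast_nonneg (α := ℚ) R)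
  have hsum := two_mul_sum_range_sub (X := τ + S + R) (R := R) (by omega)
  have : ((∑ j ∈ Finset.range R, (τ + S + R - j) : ℕ) : ℚ) < (((ρ + 1) * (τ + 1) : ℕ) : ℚ) := by
    push_cast at hsum ⊢
    linarith
  exact_mod_cast this

/-! ### Construction of a telescoper within the bounds. -/

lemma RecOp.order_le_and_deg_le {L : RecOp K} {ρ τ : ℕ} {c : Fin (ρ + 1) → K[X]}
    (hL : ∀ ℓ : Fin (ρ + 1), SkewPolynomial.coeff L ℓ = c ℓ)
    (hL0 : ∀ n, ρ < n → SkewPolynomial.coeff L n = 0) (hc : ∀ ℓ, (c ℓ).natDegree ≤ τ) :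
    L.order ≤ ρ ∧ L.deg ≤ τ := by
  have hle : ∀ n ∈ SkewPolynomial.support L, n ≤ ρ := fun n hn => by
    by_contra! h
    exact SkewPolynomial.mem_support_iff.1 hn (hL0 n h)
  refine ⟨Finset.sup_le hle, Finset.sup_le fun n hn => ?_⟩
  have := hL ⟨n, Nat.lt_succ_of_le (hle n hn)⟩
  simp only at this
  rw [this]
  exact hc _

lemma exists_telescoper_zero (ρ τ : ℕ) :
    ∃ L : RecOp K, IsTelescoper L 0 ∧ L.order ≤ ρ ∧ L.deg ≤ τ := by
  obtain ⟨L, hL, hL0⟩ := exists_recOp (K := K) (ρ := ρ) (fun _ => 1)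
  refine ⟨L, ⟨fun h => ?_, ?_⟩, RecOp.order_le_and_deg_le hL hL0 fun _ => by simp⟩
  · have := hL 0
    rw [h] at this
    exact zero_ne_one this
  · simpa [RecOp.app] using isSummable_zero

lemma RefinedILD.exists_telescoper [CharZero K] {a b : PolyXY K} {u : K[X]} (hu : u ≠ 0)
    (hdeg : a.degree < b.degree) (ha : a ≠ 0) (hil : IsIntegerLinear b) (D : RefinedILD b)
    {ρ τ : ℕ} (hρ : D.rhoNat ≤ ρ)
    (hτ : (τ : ℚ) > ((((ρ : ℚ) + 1) * (degX b : ℕ) * (b.natDegree : ℕ) + ρ * (u.natDegree : ℕ) +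
      (degX a : ℕ) + (D.rhoNat : ℕ)) * (D.rhoNat : ℕ) -
        1 / 2 * (D.rhoNat : ℕ) * (((D.rhoNat : ℕ) : ℚ) - 1) - ((ρ : ℚ) + 1)) /
          ((ρ : ℚ) + 1 - (D.rhoNat : ℕ))) :
    ∃ L : RecOp K, IsTelescoper L (algebraMap (PolyXY K) (RatXY K) a /
      algebraMap (PolyXY K) (RatXY K) (C u * b)) ∧ L.order ≤ ρ ∧ L.deg ≤ τ := by
  classical
  have hb0 : b ≠ 0 := ne_zero_of_degree_gt hdeg
  set q : (Σ i, Fin (D.n i)) → PolyXY K := fun w =>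
    substLin (D.p w.1) (D.lam w.1) (D.mu w.1) (D.nu w.1 w.2) ^ D.e w.1 w.2 with hq
  have hbq : b = D.p₀ * ∏ w, q w := by
    rw [Fintype.prod_sigma]
    exact D.eq_prod
  obtain ⟨d, A, hd0, hd, hAdeg, hAX, hA⟩ := exists_partialFractions (D.natDegree_p₀ hil) hbq ha hdeg
    fun w w' hww => by
      simp only [hq, map_pow]
      exact (D.isCoprime_toRatX hww).pow
  have hq0 : ∀ w, q w ≠ 0 := fun w =>
    pow_ne_zero _ (substLin_ne_zero (D.p_irreducible _) _ (D.mu_pos _).ne' _)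
  have hqdeg : ∀ w, (q w).natDegree = D.e w.1 w.2 * (D.p w.1).natDegree := fun w => by
    rw [natDegree_pow, natDegree_substLin _ _ (D.mu_pos _).ne']
  have hcof := fun (ℓ : ℕ) (w : Σ i, Fin (D.n i)) =>
    D.exists_cofactor w.1 (D.nu w.1 w.2 + D.lam w.1 * ℓ)
      (Finset.le_sup (f := D.e w.1) (Finset.mem_univ w.2) : D.e w.1 w.2 ≤ D.maxExp w.1)
  choose hle t H hHdeg hH using hcof
  have hHq : ∀ ℓ w, H ℓ w * translate ℓ (t ℓ w) (q w) = D.commonDenom := fun ℓ w => by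
    rw [hq, map_pow, translate_substLin, hH]
  have hf0 : u * d ≠ 0 := mul_ne_zero hu hd0
  set R := D.rhoNat with hR
  set P : ℕ := (b.natDegree - 1) * degX b + degX a with hP
  set S : ℕ := ρ * (u * d).natDegree + P with hS
  -- `W ℓ` brings the `ℓ`-th shift over the product of all shifts of `u * d`; it has only `ρ`
  -- factors because its own is omitted.
  set W : Fin (ρ + 1) → K[X] := fun ℓ => ∏ ℓ' ∈ Finset.univ.erase ℓ,
    (u * d).comp (X + (((ℓ' : ℕ) : ℤ) : K[X])) with hW
  have hWdeg : ∀ ℓ, (W ℓ).natDegree ≤ ρ * (u * d).natDegree := fun ℓ => by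
    refine (natDegree_prod_le _ _).trans ?_
    simp only [natDegree_comp_add_intCast]
    simp
  -- If `q w` has degree `δ` in `y`, the numerator `A w` has total degree at most `P + δ - 1` and
  -- the cofactor at most `R - δ`. The `δ` cancels, leaving a bound common to all terms.
  have hterm : ∀ (ℓ : ℕ) w, translate ℓ (t ℓ w) (A w) * H ℓ w ∈ totalDegLE K (P + (R - 1)) ∧
      ((translate ℓ (t ℓ w) (A w) * H ℓ w).natDegree < R ∨
        translate ℓ (t ℓ w) (A w) * H ℓ w = 0) := by
    intro ℓ w
    by_cases hAw : A w = 0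
    · simp [hAw]
    have h1 : (A w).natDegree < (q w).natDegree := natDegree_lt_natDegree hAw (hAdeg w)
    have h2 := hle ℓ w
    have h3 := hHdeg ℓ w
    rw [← hqdeg w] at h2 h3
    have h4 := translate_mem_totalDegLE ℓ (t ℓ w)
      (mem_totalDegLE_of_degX_natDegree (hAX w) (Nat.le_sub_one_of_lt h1))
    refine ⟨totalDegLE_mono (by omega) (mul_mem_totalDegLE h4 h3), Or.inl ?_⟩
    have h5 := natDegree_translate_le ℓ (t ℓ w) (A w)
    have h6 := natDegree_le_of_mem_totalDegLE h3
    refine natDegree_mul_le.trans_lt ?_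
    omega
  -- The coefficient of `y^j` has degree at most `S + R - 1 - j` in `x`. A multiplier of degree at
  -- most `τ` has `τ + 1` coefficients, whence the height `τ + S + R - j`.
  obtain ⟨c, hc0, hcdeg, hc⟩ := exists_relation
    (fun ℓ : Fin (ρ + 1) => C (W ℓ) * ∑ w, translate ℓ (t ℓ w) (A w) * H ℓ w)
    (fun _ => τ + 1) R (fun j => τ + S + R - j)
    (by
      intro ℓ j hj
      have hjR : j < R := by
        by_contra! h
        refine hj ?_
        rw [coeff_C_mul, finsetSum_coeff, Finset.sum_eq_zero, mul_zero]
        intro w _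
        rcases (hterm ℓ w).2 with h1 | h1
        · exact coeff_eq_zero_of_natDegree_lt (h1.trans_le h)
        · rw [h1, coeff_zero]
      have hmem := mul_mem_totalDegLE (C_mem_totalDegLE (hWdeg ℓ))
        (Submodule.sum_mem _ fun w (_ : w ∈ Finset.univ) => (hterm ℓ w).1)
      have := natDegree_coeff_add_le hmem hj
      exact ⟨hjR, by omega⟩)
    (by
      rw [Finset.sum_const, Finset.card_univ, Fintype.card_fin, smul_eq_mul]
      refine sum_range_lt_of_lt_div hρ ?_ hτ
      have : (u * d).natDegree ≤ u.natDegree + b.natDegree * degX b :=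
        natDegree_mul_le.trans (by omega)
      have := Nat.mul_le_mul_left ρ this
      omega)
  have hr : algebraMap (PolyXY K) (RatXY K) a / algebraMap (PolyXY K) (RatXY K) (C u * b) =
      ∑ w, algebraMap (PolyXY K) (RatXY K) (A w) / algebraMap _ _ (C (u * d) * q w) := by
    have hinj : Function.Injective (algebraMap (PolyXY K) (RatXY K)) :=
      IsFractionRing.injective _ _
    have hud : C (u * d) * b ≠ 0 := mul_ne_zero (C_ne_zero.2 hf0) hb0
    have hub : C u * b ≠ 0 := mul_ne_zero (C_ne_zero.2 hu) hb0
    have hw : ∀ w, algebraMap (PolyXY K) (RatXY K) (A w) / algebraMap _ _ (C (u * d) * q w) =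
        algebraMap (PolyXY K) (RatXY K) (A w * (D.p₀ * ∏ w' ∈ Finset.univ.erase w, q w')) /
          algebraMap _ _ (C (u * d) * b) := by
      intro w
      rw [div_eq_div_iff ((map_ne_zero_iff _ hinj).2 (mul_ne_zero (C_ne_zero.2 hf0) (hq0 w)))
        ((map_ne_zero_iff _ hinj).2 hud), ← map_mul, ← map_mul]
      refine congrArg _ ?_
      conv_lhs => rw [hbq, ← Finset.mul_prod_erase _ q (Finset.mem_univ w)]
      ring
    simp only [hw, ← Finset.sum_div, ← map_sum, ← hA]
    rw [div_eq_div_iff ((map_ne_zero_iff _ hinj).2 hub) ((map_ne_zero_iff _ hinj).2 hud),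
      ← map_mul, ← map_mul]
    refine congrArg _ ?_
    rw [C_mul]
    ring
  obtain ⟨L, hL, hLc, hL0⟩ := exists_telescoper_of_relation hf0 hr D.commonDenom_ne_zero hHq hc0 hc
  refine ⟨L, hL, RecOp.order_le_and_deg_le hLc hL0 fun ℓ => ?_⟩
  exact natDegree_le_iff_coeff_eq_zero.2 fun i hi =>
    coeff_eq_zero_of_degree_lt ((mem_degreeLT.1 (hcdeg ℓ)).trans_le (by exact_mod_cast hi))

end RationalCT

theorem lemma6p4 {K : Type*} [Field K] [CharZero K]
    (r : RationalCT.RatXY K) (hr : ∃ f, RationalCT.IsShiftRemainder f r)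
    (a b : RationalCT.PolyXY K) (u : Polynomial K) (hu : u ≠ 0)
    (hrab : r = algebraMap (RationalCT.PolyXY K) (RationalCT.RatXY K) a /
      algebraMap (RationalCT.PolyXY K) (RationalCT.RatXY K) (Polynomial.C u * b))
    (hdeg : a.degree < b.degree)
    (hcop : IsRelPrime a (Polynomial.C u * b))
    (hprim : b.IsPrimitive)
    (hfree : RationalCT.IsShiftFree b)
    (hil : RationalCT.IsIntegerLinear b)
    (D : RationalCT.RefinedILD b)
    (ρ τ : ℕ) (hρ : D.rho₀ ≤ (ρ : ℤ))
    (hτ : (τ : ℚ) >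
      ((((ρ : ℚ) + 1) * (RationalCT.degX b : ℚ) * (b.natDegree : ℚ)
            + (ρ : ℚ) * (u.natDegree : ℚ) + (RationalCT.degX a : ℚ) + (D.rho₀ : ℚ)) * (D.rho₀ : ℚ)
          - 1 / 2 * (D.rho₀ : ℚ) * ((D.rho₀ : ℚ) - 1) - ((ρ : ℚ) + 1))
        / ((ρ : ℚ) + 1 - (D.rho₀ : ℚ))) :
    ∃ L : RationalCT.RecOp K,
      RationalCT.IsTelescoper L r ∧ L.order ≤ ρ ∧ L.deg ≤ τ := by
  -- Every operator annihilates the zero function; the partial fraction count needs `a ≠ 0`.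
  by_cases ha : a = 0
  · rw [hrab, ha, map_zero, zero_div]
    exact RationalCT.exists_telescoper_zero ρ τ
  · rw [D.rho₀_eq] at hρ hτ
    rw [hrab]
    exact D.exists_telescoper hu hdeg ha hil (by exact_mod_cast hρ) (by exact_mod_cast hτ)
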